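/- **Setting.** An attributed graph with $n$ nodes is a pair $G=(A,X)$ of an adjacency matrix $A\in\mathbb R^{n\times n}$ and node features $X_1,\dots,X_n\in\mathbb R^p$. Fix $k\ge 0$; the ego-graph of a node $v$ is the subgraph of $G$ induced on the nodes reachable from $v$ in at most $k$ steps along nonzero entries of $A$, with centre $v$. Let $\mathcal G$ be the set of all such ego-graphs (attributed graphs with a centre from which every node is at most $k$ steps away), with a (pseudo-)distance $c$ for which $\mathcal G$ is separable, and with its Borel $\sigma$-algebra. For a (deterministic or random) graph $G$, $\mathbb P(G)$ denotes the distribution of all the ego-graphs of $G$, i.e. the law of the ego-graph of a uniformly chosen node of $G$. $W_1(\mu,\nu)=\inf_\gamma\int c\,d\gamma$, over all couplings $\gamma$ of $\mu$ and $\nu$, is the Wasserstein distance. Let $G^{\mathcal S}$, $G^{\mathcal T}$ be a source and a target graph, each with a fixed number of nodes (positive for $G^{\mathcal T}$), and $\psi^{\mathcal S},\psi^{\mathcal T}:\mathcal G\to\mathcal Y=[0,1]$ the (measurable) true labeling functions. The source sample consists of $n^{\mathcal S}\ge 1$ independent ego-graphs $E_1,\dots,E_{n^{\mathcal S}}$ whose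 average law is $\mathbb P(G^{\mathcal S})$ (for example, i.i.d. with law $\mathbb P(G^{\mathcal S})$). Let $\mathcal M$ be a set of models $(g,f)$ with feature extractor $f:\mathcal G\to\mathcal Z$ and classifier $g:\mathcal Z\to\mathcal Y$, and $\mathcal H=\{h=g\circ f:(g,f)\in\mathcal M\}$. Assume that every $h\in\mathcal H$ is $L_{\mathrm{GNN}}$-Lipschitz and that $\mathcal H$ has pseudo-dimension $\operatorname{Pdim}(\mathcal H)=d<\infty$, i.e. $d$ is the largest size of a finite set $\{x_1,\dots,x_m\}\subset\mathcal G$ for which there are thresholds $t_1,\dots,t_m\in\mathbb R$ such that for every $b\subseteq\{1,\dots,m\}$ some $h\in\mathcal H$ satisfies $h(x_i)>t_i\iff i\in b$. Assume $d\le 2n^{\mathcal S}$. Put, for $h=g\circ f$, $$\epsilon^{\mathcal S}(h)=\mathbb E_{u\sim\mathbb P(G^{\mathcal S})}|h(u)-\psi^{\mathcal S}(u)|,\qquad \epsilon^{\mathcal T}(h)=\mathbb E_{u\sim\mathbb P(G^{\mathcal T})}|h(u)-\psi^{\mathcal T}(u)|,$$ $$\hat\epsilon^{\mathcal S}(h)=\frac1{n^{\mathcal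 S}}\sum_{i=1}^{n^{\mathcal S}}|h(E_i)-\psi^{\mathcal S}(E_i)|,\qquad \eta=\inf_{h^*\in\mathcal H}\{\epsilon^{\mathcal S}(h^*)+\epsilon^{\mathcal T}(h^*)\}.$$ **Theorem 1 (Generalization bound for UGDA).** Let $0<\delta<1$. With probability at least $1-\delta$ over the source sample, all $h\in\mathcal H$ simultaneously satisfy $$\epsilon^{\mathcal T}(h)\le\hat\epsilon^{\mathcal S}(h)+\eta+2L_{\mathrm{GNN}}\,W_1\big(\mathbb P(G^{\mathcal S}),\mathbb P(G^{\mathcal T})\big)+\sqrt{\frac{4d}{n^{\mathcal S}}\log\Big(\frac{e\,n^{\mathcal S}}{d}\Big)+\frac1{n^{\mathcal S}}\log\Big(\frac1\delta\Big)}.$$ (For $d=0$ the first summand under the root is $0$; when $L_{\mathrm{GNN}}=0$ the third term is $0$.) -/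

import Mathlib

open MeasureTheory ProbabilityTheory
open scoped ENNReal NNReal

/-- An attributed graph on the nodes `0, …, n - 1`: a (weighted, possibly directed) adjacency
matrix and a feature vector in `ℝ^p` at every node. There is an edge from `u` to `w` when
`adj u w ≠ 0`. -/
structure AttrGraph (n p : ℕ) where
  adj : Matrix (Fin n) (Fin n) ℝ
  feat : Fin n → EuclideanSpace ℝ (Fin p)

namespace AttrGraph

variable {n p : ℕ}

/-- The nodes that can be reached from `v` by a walk of at most `k` edges. -/
def ball (G : AttrGraph n p) (v : Fin n) : ℕ → Set (Fin n)
  | 0 => {v}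
  | k + 1 => G.ball v k ∪ {w | ∃ u ∈ G.ball v k, G.adj u w ≠ 0}

/-- The same nodes, as a finite set. -/
noncomputable def ballFinset (G : AttrGraph n p) (v : Fin n) (k : ℕ) : Finset (Fin n) :=
  (Set.toFinite (G.ball v k)).toFinset

/-- The subgraph induced on a finite set `S` of nodes, its nodes being renumbered increasingly. -/
def induce (G : AttrGraph n p) (S : Finset (Fin n)) : AttrGraph S.card p where
  adj i j := G.adj (S.orderIsoOfFin rfl i) (S.orderIsoOfFin rfl j)
  feat i := G.feat (S.orderIsoOfFin rfl i)

theorem mem_ball_self (G : AttrGraph n p) (v : Fin n) (k : ℕ) : v ∈ G.ball v k := by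
  induction k with
  | zero => exact rfl
  | succ k ih => exact Or.inl ih

theorem mem_ballFinset {G : AttrGraph n p} {v w : Fin n} {k : ℕ} :
    w ∈ G.ballFinset v k ↔ w ∈ G.ball v k := by
  simp [ballFinset]

theorem ball_mono (G : AttrGraph n p) (v : Fin n) {j k : ℕ} (h : j ≤ k) :
    G.ball v j ⊆ G.ball v k := by
  induction h with
  | refl => exact subset_rfl
  | step _ ih => exact fun w hw => Or.inl (ih hw)

end AttrGraph

/-- A `k`-hop ego-graph with features in `ℝ^p`: an attributed graph with a central node, all of
whose nodes are at most `k` hops away from the centre. -/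
structure EgoGraph (k p : ℕ) where
  size : ℕ
  graph : AttrGraph size p
  center : Fin size
  reach : ∀ w, w ∈ graph.ball center k

namespace AttrGraph

variable {n p : ℕ}

/-- The centre `v`, as a node of the subgraph induced on its `k`-hop neighbourhood. -/
noncomputable def egoCenter (G : AttrGraph n p) (k : ℕ) (v : Fin n) :
    Fin (G.ballFinset v k).card :=
  ((G.ballFinset v k).orderIsoOfFin rfl).symm ⟨v, mem_ballFinset.2 (G.mem_ball_self v k)⟩

theorem reach_induce (G : AttrGraph n p) (k : ℕ) (v : Fin n) {j : ℕ} (hj : j ≤ k) (w : Fin n)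
    (hw : w ∈ G.ball v j) :
    ((G.ballFinset v k).orderIsoOfFin rfl).symm ⟨w, mem_ballFinset.2 (G.ball_mono v hj hw)⟩ ∈
      (G.induce (G.ballFinset v k)).ball (G.egoCenter k v) j := by
  induction j generalizing w with
  | zero =>
    obtain rfl : w = v := hw
    exact rfl
  | succ j ih =>
    rcases hw with hw | ⟨u, hu, huw⟩
    · exact Or.inl (ih (by omega) w hw)
    · refine Or.inr ⟨_, ih (by omega) u hu, ?_⟩
      simpa only [induce, OrderIso.apply_symm_apply] using huw

/-- The `k`-hop ego-graph of the node `v` of `G`: the subgraph induced on the nodes that are at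
most `k` hops away from `v`, with centre `v`. -/
noncomputable def ego (G : AttrGraph n p) (k : ℕ) (v : Fin n) : EgoGraph k p where
  size := (G.ballFinset v k).card
  graph := G.induce (G.ballFinset v k)
  center := G.egoCenter k v
  reach w := by
    have h := G.reach_induce k v le_rfl ((G.ballFinset v k).orderIsoOfFin rfl w)
      (mem_ballFinset.1 ((G.ballFinset v k).orderIsoOfFin rfl w).2)
    simpa only [Subtype.coe_eta, OrderIso.symm_apply_apply] using h

end AttrGraph

/-- The distribution of all the `k`-hop ego-graphs of a (random) graph `G` with `n` nodes: the
law of the ego-graph of a uniformly chosen node. For a deterministic graph it is the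
empirical distribution of its `n` ego-graphs. -/
noncomputable def egoDist {Ω : Type*} [MeasurableSpace Ω] {n p : ℕ} (k : ℕ)
    [MeasurableSpace (EgoGraph k p)] (P : Measure Ω) (G : Ω → AttrGraph n p) :
    Measure (EgoGraph k p) :=
  (n : ℝ≥0∞)⁻¹ • ∑ v : Fin n, P.map fun ω => (G ω).ego k v

/-- The Wasserstein distance of order one: the infimum of the expected distance over all
couplings. -/
noncomputable def wassersteinOne {X : Type*} [PseudoMetricSpace X] [MeasurableSpace X]
    (μ ν : Measure X) : ℝ≥0∞ :=
  ⨅ γ : Measure (X × X), ⨅ _ : γ.map Prod.fst = μ ∧ γ.map Prod.snd = ν,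
    ∫⁻ z, edist z.1 z.2 ∂γ

/-- The finite set `s` is pseudo-shattered by `H`: for suitable thresholds, every subset of `s`
is cut out by some `h ∈ H` as the set of points where `h` exceeds the threshold. -/
def PseudoShatters {X : Type*} (H : Set (X → unitInterval)) (s : Finset X) : Prop :=
  ∃ t : X → ℝ, ∀ b : Finset X, b ⊆ s → ∃ h ∈ H, ∀ x ∈ s, t x < (h x : ℝ) ↔ x ∈ b

/-- The pseudo-dimension: the largest size of a pseudo-shattered set. -/
noncomputable def pseudoDim {X : Type*} (H : Set (X → unitInterval)) : ℕ∞ :=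
  ⨆ s : Finset X, ⨆ _ : PseudoShatters H s, (s.card : ℕ∞)

/-- The hypotheses `g ∘ f` given by a set of models, a model being a pair of a classifier `g` and a
feature extractor `f`. -/
def hypothesisSet {X Z : Type*} (M : Set ((Z → unitInterval) × (X → Z))) :
    Set (X → unitInterval) :=
  {h | ∃ m ∈ M, h = m.1 ∘ m.2}

/-- The expected classification error of `h` under `μ`, for the labeling function `ψ`. -/
noncomputable def risk {X : Type*} [MeasurableSpace X] (μ : Measure X) (ψ h : X → unitInterval) :
    ℝ :=
  ∫ x, |(h x : ℝ) - ψ x| ∂μ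

/-- The empirical classification error of `h` on the `n` inputs `x`, that is `1 / n` times the
`ℓ¹`-norm of the vector of the `n` errors. -/
noncomputable def empiricalRisk {X : Type*} {n : ℕ} (x : Fin n → X) (ψ h : X → unitInterval) : ℝ :=
  (1 / (n : ℝ)) * ∑ i, |(h (x i) : ℝ) - ψ (x i)|

/-- The optimal combined error on both domains that a hypothesis in `H` can achieve. -/
noncomputable def jointError {X : Type*} [MeasurableSpace X] (μS μT : Measure X)
    (ψS ψT : X → unitInterval) (H : Set (X → unitInterval)) : ℝ :=
  ⨅ h : H, (risk μS ψS h + risk μT ψT h)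

/-! The bound separates a change of domain from a uniform deviation. For every `g ∈ H` the triangle
inequality bounds the target risk of `h` by the target mean of `|h - g|` plus the target risk of
`g`. Since `|h - g|` is `2L`-Lipschitz, replacing its target mean by its source mean costs at most
`2L` times the Wasserstein distance, and the source mean is at most the sum of the source risks of
`h` and `g`. The infimum over `g` gives the joint error (`risk_target_le`).

It remains to bound the source risk by the empirical one, uniformly in `h`. Let `d ≤ n`. The largest
deviation over a finite subclass has bounded differences, so McDiarmid's inequality concentrates it
around its mean, and symmetrization bounds that mean by Rademacher averages of the losses. These
need no covering numbers: `|a - b|` is the integral over thresholds `t` of the indicator that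
exactly one of `a`, `b` exceeds `t`. For fixed `t`, the level sets `{h > t}` cut out of the sample a
family of VC dimension at most `d`, because shattering with a constant threshold is
pseudo-shattering. Sauer's and Massart's lemmas then apply at each `t` (`sum_signs_sup_loss_le`).

The finite bound does not depend on the size of the subclass, so it passes to countable classes, and
from a countable pointwise dense subclass to `H`. If `n < d ≤ 2n`, the root is already at least 1
and nothing is left to prove. -/

/-! ### Bounded differences and McDiarmid's inequality -/

theorem integrable_of_abs_le {Y : Type*} [MeasurableSpace Y] {μ : Measure Y} [IsFiniteMeasure μ]
    {f : Y → ℝ} (hf : Measurable f) {B : ℝ} (hB : ∀ y, |f y| ≤ B) : Integrable f μ :=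
  Integrable.of_bound hf.aestronglyMeasurable B (ae_of_all _ hB)

theorem measurable_fin_cons {n : ℕ} {X : Type*} [MeasurableSpace X] :
    Measurable fun z : X × (Fin n → X) => (Fin.cons z.1 z.2 : Fin (n + 1) → X) := by
  refine measurable_pi_iff.2 fun i => ?_
  refine Fin.cases ?_ (fun j => ?_) i
  · simpa using measurable_fst
  · simpa using! (measurable_pi_apply j).comp measurable_snd

/-- Integration over a finite power, one coordinate first. -/
theorem integral_pi_succ {n : ℕ} {X : Type*} [MeasurableSpace X] (μ : Fin (n + 1) → Measure X)
    [∀ i, IsProbabilityMeasure (μ i)] {f : (Fin (n + 1) → X) → ℝ} (hf : Measurable f) {B : ℝ}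
    (hB : ∀ x, |f x| ≤ B) :
    ∫ x, f x ∂Measure.pi μ
      = ∫ y, ∫ a, f (Fin.cons a y) ∂μ 0 ∂Measure.pi fun i : Fin n => μ i.succ := by
  have h := (measurePreserving_piFinSuccAbove μ 0).symm
  have h2 := h.integral_comp (MeasurableEquiv.measurableEmbedding _) f
  rw [← h2]
  have h3 : ∀ z : X × (Fin n → X),
      (MeasurableEquiv.piFinSuccAbove (fun _ : Fin (n + 1) => X) 0).symm z = Fin.cons z.1 z.2 := by
    intro z
    simp [MeasurableEquiv.piFinSuccAbove, Fin.insertNthEquiv]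
  simp only [h3]
  rw [integral_prod_symm]
  · rfl
  · exact integrable_of_abs_le (hf.comp measurable_fin_cons) fun z => hB _

/-- The exponential moments of a function with bounded differences under a product measure. -/
theorem integral_exp_sub_le_of_boundedDifferences {X : Type*} [MeasurableSpace X] {c : ℝ}
    (hc : 0 ≤ c) (t : ℝ) : ∀ {n : ℕ} (μ : Fin n → Measure X) [∀ i, IsProbabilityMeasure (μ i)]
    {f : (Fin n → X) → ℝ} (_ : Measurable f) {B : ℝ} (_ : ∀ x, |f x| ≤ B)
    (_ : ∀ x i a, f (Function.update x i a) ≤ f x + c),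
    ∫ x, Real.exp (t * (f x - ∫ y, f y ∂Measure.pi μ)) ∂Measure.pi μ
      ≤ Real.exp (n * (c / 2) ^ 2 * t ^ 2 / 2) := by
  intro n
  induction n with
  | zero =>
    intro μ _ f hf B hB hd
    have h : ∀ x, f x = f default := fun x => by rw [Subsingleton.elim x default]
    simp [h]
  | succ n ih =>
    intro μ _ f hf B hB hd
    have : Nonempty X := (μ 0).nonempty_of_neZero
    set ν := Measure.pi fun i : Fin n => μ i.succ with hν
    set g : (Fin n → X) → ℝ := fun y => ∫ a, f (Fin.cons a y) ∂μ 0 with hg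
    have hcons (y : Fin n → X) : Measurable fun a => f (Fin.cons a y) :=
      (hf.comp measurable_fin_cons).comp (measurable_id.prodMk measurable_const)
    have hint (y : Fin n → X) : Integrable (fun a => f (Fin.cons a y)) (μ 0) :=
      integrable_of_abs_le (hcons y) fun a => hB _
    have hgm : Measurable g :=
      ((hf.comp measurable_fin_cons).stronglyMeasurable.integral_prod_left'
        (μ := μ 0)).measurable
    have hgB (y) : |g y| ≤ B := by
      have := norm_integral_le_of_norm_le_const (μ := μ 0) (f := fun a => f (Fin.cons a y))
        (ae_of_all _ fun a => hB _)
      simpa using this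
    have hgd (y i b) : g (Function.update y i b) ≤ g y + c := by
      have h1 : g y + c = ∫ a, (f (Fin.cons a y) + c) ∂μ 0 := by
        rw [integral_add (hint y) (integrable_const c)]; simp [hg]
      rw [h1]
      refine integral_mono (hint _) ((hint y).add (integrable_const c)) fun a => ?_
      have := hd (Fin.cons a y) i.succ b
      rwa [← Fin.cons_update] at this
    have hfg : ∫ x, f x ∂Measure.pi μ = ∫ y, g y ∂ν := integral_pi_succ μ hf hB
    have hIg := ih (fun i => μ i.succ) hgm hgB hgd
    rw [hfg]
    set m := ∫ y, g y ∂ν with hm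
    -- Hoeffding's lemma in the first coordinate: with `y` fixed, the values of `f` lie in an
    -- interval of length `c` that starts at their infimum.
    have hin (y) : ∫ a, Real.exp (t * (f (Fin.cons a y) - g y)) ∂μ 0
        ≤ Real.exp ((c / 2) ^ 2 * t ^ 2 / 2) := by
      have hbdd : BddBelow (Set.range fun a => f (Fin.cons a y)) :=
        ⟨-B, by rintro _ ⟨a, rfl⟩; exact (abs_le.1 (hB _)).1⟩
      have hmem (a) : f (Fin.cons a y) ∈
          Set.Icc (⨅ b, f (Fin.cons b y)) ((⨅ b, f (Fin.cons b y)) + c) := by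
        refine ⟨ciInf_le hbdd a, ?_⟩
        rw [← sub_le_iff_le_add]
        refine le_ciInf fun b => ?_
        have := hd (Fin.cons b y) 0 a
        rw [Fin.update_cons_zero] at this
        linarith
      have h := (hasSubgaussianMGF_of_mem_Icc (μ := μ 0) (hcons y).aemeasurable
        (ae_of_all _ hmem)).mgf_le t
      simpa [mgf, hg, abs_of_nonneg hc] using h
    have hK (x) : |Real.exp (t * (f x - m))| ≤ Real.exp (|t| * (B + |m|)) := by
      rw [abs_of_pos (Real.exp_pos _), Real.exp_le_exp]
      calc t * (f x - m) ≤ |t * (f x - m)| := le_abs_self _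
        _ = |t| * |f x - m| := abs_mul _ _
        _ ≤ |t| * (B + |m|) := by
          gcongr
          exact (abs_sub _ _).trans (by gcongr; exact hB x)
    have hem : Measurable fun x => Real.exp (t * (f x - m)) := by fun_prop
    rw [integral_pi_succ μ hem hK]
    have hEg : Integrable (fun y => Real.exp (t * (g y - m))) ν := by
      refine integrable_of_abs_le (B := Real.exp (|t| * (B + |m|))) (by fun_prop) fun y => ?_
      rw [abs_of_pos (Real.exp_pos _), Real.exp_le_exp]
      calc t * (g y - m) ≤ |t * (g y - m)| := le_abs_self _
        _ = |t| * |g y - m| := abs_mul _ _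
        _ ≤ |t| * (B + |m|) := by
          gcongr
          exact (abs_sub _ _).trans (by gcongr; exact hgB y)
    calc ∫ y, ∫ a, Real.exp (t * (f (Fin.cons a y) - m)) ∂μ 0 ∂ν
        ≤ ∫ y, Real.exp ((c / 2) ^ 2 * t ^ 2 / 2) * Real.exp (t * (g y - m)) ∂ν := by
          refine integral_mono_of_nonneg (ae_of_all _ fun y => integral_nonneg fun a =>
            (Real.exp_pos _).le) (hEg.const_mul _) (ae_of_all _ fun y => ?_)
          -- Since `f - m = (f - g) + (g - m)` and `g` does not depend on `a`, the second factor
          -- leaves the inner integral.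
          have h1 (a) : Real.exp (t * (f (Fin.cons a y) - m))
              = Real.exp (t * (f (Fin.cons a y) - g y)) * Real.exp (t * (g y - m)) := by
            rw [← Real.exp_add]; ring_nf
          simp only [h1]
          rw [integral_mul_const]
          exact mul_le_mul_of_nonneg_right (hin y) (Real.exp_pos _).le
      _ = Real.exp ((c / 2) ^ 2 * t ^ 2 / 2) * ∫ y, Real.exp (t * (g y - m)) ∂ν :=
          integral_const_mul _ _
      _ ≤ Real.exp ((c / 2) ^ 2 * t ^ 2 / 2) * Real.exp (n * (c / 2) ^ 2 * t ^ 2 / 2) :=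
          mul_le_mul_of_nonneg_left hIg (Real.exp_pos _).le
      _ = Real.exp ((n + 1 : ℕ) * (c / 2) ^ 2 * t ^ 2 / 2) := by
          rw [← Real.exp_add]; push_cast; ring_nf

/-- **McDiarmid's inequality** for differences bounded by one. -/
theorem measureReal_boundedDifferences_le {X : Type*} [MeasurableSpace X] {n : ℕ}
    (μ : Fin n → Measure X) [∀ i, IsProbabilityMeasure (μ i)]
    {f : (Fin n → X) → ℝ} (hf : Measurable f) {B : ℝ} (hB : ∀ x, |f x| ≤ B)
    (hd : ∀ x i a, f (Function.update x i a) ≤ f x + 1) {ε : ℝ} (hε : 0 ≤ ε) :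
    (Measure.pi μ).real {x | ε ≤ f x - ∫ y, f y ∂Measure.pi μ} ≤ Real.exp (-2 * ε ^ 2 / n) := by
  set m := ∫ y, f y ∂Measure.pi μ with hm
  have h : HasSubgaussianMGF (fun x => f x - m) ((n : ℝ≥0) * (1 / 2) ^ 2) (Measure.pi μ) := by
    refine ⟨fun t => ?_, fun t => ?_⟩
    · refine integrable_of_abs_le (B := Real.exp (|t| * (B + |m|))) (by fun_prop) fun y => ?_
      rw [abs_of_pos (Real.exp_pos _), Real.exp_le_exp]
      calc t * (f y - m) ≤ |t * (f y - m)| := le_abs_self _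
        _ = |t| * |f y - m| := abs_mul _ _
        _ ≤ |t| * (B + |m|) := by
          gcongr
          exact (abs_sub _ _).trans (by gcongr; exact hB y)
    · have := integral_exp_sub_le_of_boundedDifferences zero_le_one t μ hf hB hd
      simpa [mgf] using this
  refine (h.measure_ge_le hε).trans (le_of_eq ?_)
  congr 1
  push_cast
  rcases eq_or_ne (n : ℝ) 0 with h0 | h0
  · simp [h0]
  · field_simp

/-! ### Random signs and Massart's lemma -/

/-- The sign `±1` given by a Boolean. -/
def boolSign (b : Bool) : ℝ := if b then 1 else -1

theorem boolSign_not (b : Bool) : boolSign (!b) = -boolSign b := by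
  cases b <;> simp [boolSign]

theorem abs_boolSign (b : Bool) : |boolSign b| = 1 := by
  cases b <;> simp [boolSign]

theorem sum_signs_comp_not {n : ℕ} (φ : (Fin n → Bool) → ℝ) :
    ∑ σ : Fin n → Bool, φ (fun i => !σ i) = ∑ σ, φ σ :=
  (Equiv.arrowCongr (Equiv.refl (Fin n)) Equiv.boolNot).sum_comp φ

theorem sum_signs_linear_eq_zero {n : ℕ} (a : Fin n → ℝ) :
    ∑ σ : Fin n → Bool, ∑ i, boolSign (σ i) * a i = 0 := by
  have h := sum_signs_comp_not fun σ : Fin n → Bool => ∑ i, boolSign (σ i) * a i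
  simp only [boolSign_not, neg_mul, Finset.sum_neg_distrib] at h
  linarith

/-- The sum factors into the product of `2 * cosh (a i)`, and `cosh x ≤ exp (x ^ 2 / 2)`. -/
theorem sum_signs_exp_le {n : ℕ} (a : Fin n → ℝ) :
    ∑ σ : Fin n → Bool, Real.exp (∑ i, boolSign (σ i) * a i)
      ≤ 2 ^ n * Real.exp ((∑ i, a i ^ 2) / 2) := by
  have h := Finset.prod_univ_sum (fun _ : Fin n => (Finset.univ : Finset Bool))
    fun i b => Real.exp (boolSign b * a i)
  rw [Fintype.piFinset_univ] at h
  simp only [Real.exp_sum]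
  rw [← h, Finset.sum_div, Real.exp_sum]
  have h2 : (2 : ℝ) ^ n = ∏ _i : Fin n, 2 := by simp
  rw [h2, ← Finset.prod_mul_distrib]
  refine Finset.prod_le_prod (fun i _ => by positivity) fun i _ => ?_
  have := Real.cosh_le_exp_half_sq (a i)
  rw [Real.cosh_eq] at this
  simp only [Fintype.sum_bool, boolSign, if_true, Bool.false_eq_true, if_false, one_mul, neg_mul]
  linarith

/-- **Massart's lemma** for a finite family of sets, with indicators centred at `1 / 2`. -/
theorem sum_signs_sup_indicator_le {n : ℕ} (hn : 0 < n) (𝒜 : Finset (Finset (Fin n)))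
    (h𝒜 : 𝒜.Nonempty) {K : ℝ} (hK : Real.log 𝒜.card ≤ K) :
    ∑ σ : Fin n → Bool,
        𝒜.sup' h𝒜 (fun b => ∑ i, boolSign (σ i) * if i ∈ b then (1 : ℝ) else 0)
      ≤ 2 ^ n * Real.sqrt (n * K / 2) := by
  have hn' : (0 : ℝ) < n := by exact_mod_cast hn
  -- Centring makes every entry `±1/2`, so the squared norm is exactly `n / 4`; the shift is the
  -- same for all sets and averages to zero over the signs.
  set v : Finset (Fin n) → Fin n → ℝ := fun b i => (if i ∈ b then (1 : ℝ) else 0) - 1 / 2 with hv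
  set S : ℝ := ∑ σ : Fin n → Bool, 𝒜.sup' h𝒜 (fun b => ∑ i, boolSign (σ i) * v b i) with hS
  have hsum : ∑ σ : Fin n → Bool,
      𝒜.sup' h𝒜 (fun b => ∑ i, boolSign (σ i) * if i ∈ b then (1 : ℝ) else 0) = S := by
    have h1 : ∀ σ : Fin n → Bool,
        𝒜.sup' h𝒜 (fun b => ∑ i, boolSign (σ i) * if i ∈ b then (1 : ℝ) else 0)
          = 𝒜.sup' h𝒜 (fun b => ∑ i, boolSign (σ i) * v b i)
            + ∑ i, boolSign (σ i) * (1 / 2) := by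
      intro σ
      rw [Finset.sup'_add]
      refine Finset.sup'_congr _ rfl fun b _ => ?_
      rw [← Finset.sum_add_distrib]
      refine Finset.sum_congr rfl fun i _ => ?_
      simp only [hv]; ring
    rw [Finset.sum_congr rfl fun σ _ => h1 σ, Finset.sum_add_distrib,
      sum_signs_linear_eq_zero fun _ => (1 / 2 : ℝ), add_zero]
  rw [hsum]
  have hcard : (∑ _σ : Fin n → Bool, (1 : ℝ)) = 2 ^ n := by simp
  have hvsq (b) : ∑ i, v b i ^ 2 = n / 4 := by
    have : ∀ i, v b i ^ 2 = 1 / 4 := by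
      intro i; simp only [hv]; split_ifs <;> norm_num
    simp [this]; ring
  have hcpos : (0 : ℝ) < 𝒜.card := by exact_mod_cast h𝒜.card_pos
  -- The tangent line `u ≤ c - 1 + exp (u - c)` replaces Jensen's inequality. This `c` makes the
  -- sign average of the sum of exponentials at most `exp c`.
  have key (l : ℝ) (hl : 0 < l) : l * S ≤ 2 ^ n * (K + l ^ 2 * n / 8) := by
    set c := K + l ^ 2 * n / 8 with hc
    have h1 (σ : Fin n → Bool) : l * 𝒜.sup' h𝒜 (fun b => ∑ i, boolSign (σ i) * v b i)
        ≤ (c - 1) + Real.exp (-c) * ∑ b ∈ 𝒜, Real.exp (∑ i, boolSign (σ i) * (l * v b i)) := by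
      obtain ⟨b, hb, hb'⟩ := Finset.exists_mem_eq_sup' h𝒜
        (fun b => ∑ i, boolSign (σ i) * v b i)
      rw [hb']
      have h2 : Real.exp (∑ i, boolSign (σ i) * (l * v b i))
          ≤ ∑ b ∈ 𝒜, Real.exp (∑ i, boolSign (σ i) * (l * v b i)) :=
        Finset.single_le_sum (f := fun b => Real.exp (∑ i, boolSign (σ i) * (l * v b i)))
          (fun _ _ => (Real.exp_pos _).le) hb
      have h3 : ∑ i, boolSign (σ i) * (l * v b i) = l * ∑ i, boolSign (σ i) * v b i := by
        rw [Finset.mul_sum]; exact Finset.sum_congr rfl fun i _ => by ring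
      rw [h3] at h2
      have h4 := Real.add_one_le_exp (l * ∑ i, boolSign (σ i) * v b i - c)
      have h5 := mul_le_mul_of_nonneg_left h2 (Real.exp_pos (-c)).le
      rw [← Real.exp_add, neg_add_eq_sub] at h5
      linarith
    have h6 : ∑ σ : Fin n → Bool, ∑ b ∈ 𝒜, Real.exp (∑ i, boolSign (σ i) * (l * v b i))
        ≤ 2 ^ n * Real.exp c := by
      rw [Finset.sum_comm]
      calc _ ≤ ∑ b ∈ 𝒜, 2 ^ n * Real.exp (l ^ 2 * n / 8) := by
            refine Finset.sum_le_sum fun b _ => (sum_signs_exp_le _).trans (le_of_eq ?_)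
            simp only [mul_pow, ← Finset.mul_sum, hvsq]
            ring_nf
        _ = 2 ^ n * (Real.exp (Real.log 𝒜.card) * Real.exp (l ^ 2 * n / 8)) := by
            rw [Finset.sum_const, nsmul_eq_mul, Real.exp_log hcpos]; ring
        _ ≤ 2 ^ n * Real.exp c := by
            rw [hc, Real.exp_add]; gcongr
    calc l * S = ∑ σ : Fin n → Bool,
          l * 𝒜.sup' h𝒜 (fun b => ∑ i, boolSign (σ i) * v b i) := by rw [hS, Finset.mul_sum]
      _ ≤ ∑ σ : Fin n → Bool, ((c - 1) * 1 + Real.exp (-c) *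
          ∑ b ∈ 𝒜, Real.exp (∑ i, boolSign (σ i) * (l * v b i))) :=
          Finset.sum_le_sum fun σ _ => by rw [mul_one]; exact h1 σ
      _ = (c - 1) * 2 ^ n + Real.exp (-c) * ∑ σ : Fin n → Bool,
          ∑ b ∈ 𝒜, Real.exp (∑ i, boolSign (σ i) * (l * v b i)) := by
          rw [Finset.sum_add_distrib, ← Finset.mul_sum, ← Finset.mul_sum, hcard]
      _ ≤ (c - 1) * 2 ^ n + Real.exp (-c) * (2 ^ n * Real.exp c) := by gcongr
      _ = 2 ^ n * c := by
          have : Real.exp (-c) * Real.exp c = 1 := by rw [← Real.exp_add]; simp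
          linear_combination (2 ^ n : ℝ) * this
  have hp : (0 : ℝ) < 2 ^ n := by positivity
  rcases le_or_gt S 0 with hS0 | hS0
  · exact hS0.trans (by positivity)
  · set a := S / 2 ^ n with ha
    have hSa : S = 2 ^ n * a := by rw [ha]; field_simp
    have ha0 : 0 < a := by positivity
    rw [hSa]
    gcongr
    refine Real.le_sqrt_of_sq_le ?_
    -- This `l` maximizes `l * a - l ^ 2 * n / 8`.
    have h := key (4 * a / n) (by positivity)
    rw [hSa, mul_left_comm] at h
    have h := le_of_mul_le_mul_left h hp
    have e1 : 4 * a / n * a = 4 * a ^ 2 / n := by ring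
    have e2 : (4 * a / n) ^ 2 * n / 8 = 2 * a ^ 2 / n := by field_simp; norm_num
    rw [e1, e2] at h
    have h7 : 2 * a ^ 2 / n ≤ K := by
      have : 4 * a ^ 2 / n = 2 * a ^ 2 / n + 2 * a ^ 2 / n := by ring
      linarith
    rw [div_le_iff₀ hn'] at h7
    linarith

/-! ### Sauer's lemma for level sets -/

/-- As `d / n ≤ 1`, multiplying by `(d / n) ^ d` leaves at most the terms `k ≤ d` of the binomial
expansion of `(1 + d / n) ^ n`, which is at most `exp d`. -/
theorem log_sum_choose_le {n d v : ℕ} (hvd : v ≤ d) (hdn : d ≤ n) :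
    Real.log ((∑ k ∈ Finset.Iic v, n.choose k : ℕ) : ℝ)
      ≤ d * Real.log (Real.exp 1 * n / d) := by
  have hmono : ∑ k ∈ Finset.Iic v, n.choose k ≤ ∑ k ∈ Finset.Iic d, n.choose k :=
    Finset.sum_le_sum_of_subset (Finset.Iic_subset_Iic.2 hvd)
  have hpos : 0 < ∑ k ∈ Finset.Iic v, n.choose k :=
    Finset.sum_pos' (fun _ _ => Nat.zero_le _) ⟨0, by simp, by simp⟩
  have hpos' : (0 : ℝ) < ((∑ k ∈ Finset.Iic v, n.choose k : ℕ) : ℝ) := by exact_mod_cast hpos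
  rcases Nat.eq_zero_or_pos d with rfl | hd
  · have : ∑ k ∈ Finset.Iic v, n.choose k = 1 := by
      obtain rfl : v = 0 := by omega
      rw [show Finset.Iic 0 = {0} from rfl]; simp
    simp [this]
  have hd' : (0 : ℝ) < d := by exact_mod_cast hd
  have hn' : (0 : ℝ) < n := by exact_mod_cast hd.trans_le hdn
  have hx0 : (0 : ℝ) < d / n := by positivity
  have hx1 : (d / n : ℝ) ≤ 1 := by
    rw [div_le_one hn']; exact_mod_cast hdn
  have h1 : ((∑ k ∈ Finset.Iic d, n.choose k : ℕ) : ℝ) * (d / n : ℝ) ^ d ≤ Real.exp d := by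
    push_cast
    rw [Finset.sum_mul]
    calc ∑ k ∈ Finset.Iic d, (n.choose k : ℝ) * (d / n : ℝ) ^ d
        ≤ ∑ k ∈ Finset.Iic d, (n.choose k : ℝ) * (d / n : ℝ) ^ k := by
          refine Finset.sum_le_sum fun k hk => ?_
          gcongr ?_ * ?_
          exact pow_le_pow_of_le_one hx0.le hx1 (Finset.mem_Iic.1 hk)
      _ ≤ ∑ k ∈ Finset.range (n + 1), (n.choose k : ℝ) * (d / n : ℝ) ^ k := by
          refine Finset.sum_le_sum_of_subset_of_nonneg (fun k hk => ?_) fun _ _ _ => by positivity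
          rw [Finset.mem_Iic] at hk
          rw [Finset.mem_range]; omega
      _ = (d / n + 1 : ℝ) ^ n := by
          rw [add_pow]; exact Finset.sum_congr rfl fun k _ => by simp [mul_comm]
      _ ≤ Real.exp (d / n) ^ n := by gcongr; exact Real.add_one_le_exp _
      _ = Real.exp d := by rw [← Real.exp_nat_mul]; congr 1; field_simp
  have h2 : ((∑ k ∈ Finset.Iic v, n.choose k : ℕ) : ℝ) ≤ (Real.exp 1 * n / d) ^ d := by
    calc _ ≤ ((∑ k ∈ Finset.Iic d, n.choose k : ℕ) : ℝ) := by exact_mod_cast hmono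
      _ ≤ Real.exp d / (d / n : ℝ) ^ d := by rwa [le_div_iff₀ (by positivity)]
      _ = _ := by
        rw [div_pow, div_pow, mul_pow, ← Real.exp_nat_mul, mul_one]; field_simp
  calc _ ≤ Real.log ((Real.exp 1 * n / d) ^ d) := Real.log_le_log hpos' h2
    _ = _ := Real.log_pow _ _

/-- The traces of the level sets of a class of bounded pseudo-dimension, by Sauer's lemma. -/
theorem log_card_levelSets_le {X : Type*} {n d : ℕ} (hdn : d ≤ n) {H : Set (X → unitInterval)}
    (hH : ∀ s : Finset X, PseudoShatters H s → s.card ≤ d) {F : Finset (X → unitInterval)}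
    (hF : ↑F ⊆ H) (hFne : F.Nonempty) (x : Fin n → X) (t : ℝ)
    [DecidableEq (Finset (Fin n))] :
    Real.log ((F.image fun h => Finset.univ.filter fun i => t < (h (x i) : ℝ)).card)
      ≤ d * Real.log (Real.exp 1 * n / d) := by
  classical
  set 𝒜 := F.image fun h => Finset.univ.filter fun i => t < (h (x i) : ℝ) with h𝒜
  have hvc : 𝒜.vcDim ≤ d := by
    refine Finset.sup_le fun s hs => ?_
    rw [Finset.mem_shatterer] at hs
    -- Sample points may repeat, but two indices of the same point lie in the same level sets, so no
    -- shattered set contains both.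
    have hinj : Set.InjOn x s := by
      intro i hi j hj hij
      by_contra hne
      obtain ⟨u, hu, hsu⟩ := hs (Finset.singleton_subset_iff.2 hi)
      obtain ⟨h, -, rfl⟩ := Finset.mem_image.1 hu
      have h1 : i ∈ s ∩ Finset.univ.filter fun i => t < (h (x i) : ℝ) := by simp [hsu]
      have h2 : j ∉ s ∩ Finset.univ.filter fun i => t < (h (x i) : ℝ) := by
        rw [hsu]; simpa using Ne.symm hne
      simp only [Finset.mem_inter, Finset.mem_filter, Finset.mem_univ, true_and] at h1 h2
      exact h2 ⟨hj, hij ▸ h1.2⟩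
    rw [← Finset.card_image_of_injOn hinj]
    refine hH _ ⟨fun _ => t, fun b _ => ?_⟩
    obtain ⟨u, hu, hsu⟩ := hs (Finset.filter_subset (fun i => x i ∈ b) s)
    obtain ⟨h, hh, rfl⟩ := Finset.mem_image.1 hu
    refine ⟨h, hF hh, fun y hy => ?_⟩
    obtain ⟨i, hi, rfl⟩ := Finset.mem_image.1 hy
    have := Finset.ext_iff.1 hsu i
    simpa [hi] using this
  have hpos : (0 : ℝ) < 𝒜.card := by exact_mod_cast (hFne.image _).card_pos
  refine (Real.log_le_log hpos ?_).trans (log_sum_choose_le hvc hdn)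
  have h1 := 𝒜.card_le_card_shatterer.trans Finset.card_shatterer_le_sum_vcDim
  rw [Fintype.card_fin] at h1
  exact_mod_cast h1

/-! ### Rademacher averages of the absolute loss -/

/-- Exactly one of `a`, `b` exceeds `t` precisely on the half-open interval between them. This
reduces real-valued losses to indicators. -/
theorem abs_sub_eq_integral_levelSets (a b : unitInterval) :
    |(a : ℝ) - b| = ∫ t in Set.Ioc (0 : ℝ) 1, if (t < a ↔ t < b) then (0 : ℝ) else 1 := by
  wlog hab : (b : ℝ) ≤ a generalizing a b
  · rw [abs_sub_comm, this b a (le_of_not_ge hab)]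
    simp only [iff_comm]
  have h : ∀ t : ℝ, (if (t < a ↔ t < b) then (0 : ℝ) else 1)
      = (Set.Ico (b : ℝ) a).indicator (fun _ => 1) t := by
    intro t
    by_cases h1 : t < a <;> by_cases h2 : t < b <;> simp [Set.indicator, h1, h2]
    linarith
  simp only [h]
  rw [integral_indicator measurableSet_Ico, Measure.restrict_restrict measurableSet_Ico,
    setIntegral_const, abs_of_nonneg (sub_nonneg.2 hab)]
  have : volume (Set.Ico (b : ℝ) a ∩ Set.Ioc 0 1) = ENNReal.ofReal (a - b) := by
    refine le_antisymm ?_ ?_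
    · exact (measure_mono Set.inter_subset_left).trans (by simp)
    · rw [← Real.volume_Ioo]
      exact measure_mono fun t ht =>
        ⟨⟨ht.1.le, ht.2⟩, b.2.1.trans_lt ht.1, ht.2.le.trans a.2.2⟩
  rw [measureReal_def, this, ENNReal.toReal_ofReal (sub_nonneg.2 hab)]
  simp

/-- The Rademacher averages of the absolute losses of a class of bounded pseudo-dimension. -/
theorem sum_signs_sup_loss_le {X : Type*} {n d : ℕ} (hn : 0 < n) (hdn : d ≤ n)
    {H : Set (X → unitInterval)}
    (hH : ∀ s : Finset X, PseudoShatters H s → s.card ≤ d) {F : Finset (X → unitInterval)}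
    (hF : ↑F ⊆ H) (hFne : F.Nonempty) (ψ : X → unitInterval) (x : Fin n → X) :
    ∑ σ : Fin n → Bool,
        F.sup' hFne (fun h => ∑ i, boolSign (σ i) * |(h (x i) : ℝ) - ψ (x i)|)
      ≤ 2 ^ n * Real.sqrt (n * (d * Real.log (Real.exp 1 * n / d)) / 2) := by
  classical
  set R := 2 ^ n * Real.sqrt (n * (d * Real.log (Real.exp 1 * n / d)) / 2)
  set D : (X → unitInterval) → Fin n → ℝ → ℝ := fun h i t =>
    if (t < (h (x i) : ℝ) ↔ t < (ψ (x i) : ℝ)) then 0 else 1 with hD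
  have hDm (h i) : Measurable (D h i) := by
    refine Measurable.ite ?_ measurable_const measurable_const
    have : {t : ℝ | t < (h (x i) : ℝ) ↔ t < (ψ (x i) : ℝ)}
        = (Set.Iio (h (x i) : ℝ) ∩ Set.Iio (ψ (x i) : ℝ)) ∪
          ((Set.Iio (h (x i) : ℝ))ᶜ ∩ (Set.Iio (ψ (x i) : ℝ))ᶜ) := by
      ext t; simp only [Set.mem_ofPred_eq, Set.mem_union, Set.mem_inter_iff, Set.mem_Iio,
        Set.mem_compl_iff]; tauto
    rw [this]
    exact (measurableSet_Iio.inter measurableSet_Iio).union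
      (measurableSet_Iio.compl.inter measurableSet_Iio.compl)
  have hDb (h i t) : |D h i t| ≤ 1 := by
    simp only [hD]; split_ifs <;> simp
  have hsb (σ : Fin n → Bool) (h t) : |∑ i, boolSign (σ i) * D h i t| ≤ n := by
    refine (Finset.abs_sum_le_sum_abs _ _).trans ?_
    calc _ ≤ ∑ _i : Fin n, (1 : ℝ) := Finset.sum_le_sum fun i _ => by
          rw [abs_mul, abs_boolSign, one_mul]; exact hDb h i t
      _ = n := by simp
  set G : (Fin n → Bool) → ℝ → ℝ := fun σ t =>
    F.sup' hFne (fun h => ∑ i, boolSign (σ i) * D h i t) with hG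
  have hsm (σ : Fin n → Bool) (h) : Measurable fun t => ∑ i, boolSign (σ i) * D h i t :=
    Finset.measurable_fun_sum _ fun i _ => (hDm h i).const_mul _
  have hGm (σ) : Measurable (G σ) := by
    have := Finset.measurable_sup' hFne (f := fun h t => ∑ i, boolSign (σ i) * D h i t)
      fun h _ => hsm σ h
    convert this using 1
    ext t; simp [hG, Finset.sup'_apply]
  have hGb (σ t) : |G σ t| ≤ n := by
    obtain ⟨h, _, hh⟩ := Finset.exists_mem_eq_sup' hFne (fun h => ∑ i, boolSign (σ i) * D h i t)
    simp only [hG]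
    rw [hh]; exact hsb σ h t
  have hGi (σ) : Integrable (G σ) (volume.restrict (Set.Ioc (0 : ℝ) 1)) :=
    integrable_of_abs_le (hGm σ) (hGb σ)
  -- A supremum of integrals over `t` is at most the integral of the suprema.
  have h1 (σ : Fin n → Bool) :
      F.sup' hFne (fun h => ∑ i, boolSign (σ i) * |(h (x i) : ℝ) - ψ (x i)|)
        ≤ ∫ t in Set.Ioc (0 : ℝ) 1, G σ t := by
    refine Finset.sup'_le _ _ fun h hh => ?_
    have h2 : ∑ i, boolSign (σ i) * |(h (x i) : ℝ) - ψ (x i)|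
        = ∫ t in Set.Ioc (0 : ℝ) 1, ∑ i, boolSign (σ i) * D h i t := by
      rw [integral_finsetSum _ fun i _ =>
        (integrable_of_abs_le (hDm h i) (hDb h i)).const_mul _]
      refine Finset.sum_congr rfl fun i _ => ?_
      rw [integral_const_mul, abs_sub_eq_integral_levelSets]
    rw [h2]
    exact integral_mono (integrable_of_abs_le (hsm σ h) (hsb σ h)) (hGi σ) fun t =>
      Finset.le_sup' (fun h => ∑ i, boolSign (σ i) * D h i t) hh
  -- For fixed `t` the losses are indicators of the symmetric differences of the level sets of `h`
  -- with that of `ψ`; taking the difference with a fixed set does not increase their number.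
  have h3 (t : ℝ) : ∑ σ : Fin n → Bool, G σ t ≤ R := by
    set lev : (X → unitInterval) → Finset (Fin n) :=
      fun h => Finset.univ.filter fun i => t < (h (x i) : ℝ) with hlev
    set s : Finset (Fin n) := Finset.univ.filter fun i => t < (ψ (x i) : ℝ) with hs
    set 𝒜 := (F.image lev).image fun b => symmDiff b s with h𝒜
    have hne : 𝒜.Nonempty := (hFne.image _).image _
    have hcard : Real.log 𝒜.card ≤ d * Real.log (Real.exp 1 * n / d) :=
      (Real.log_le_log (by exact_mod_cast hne.card_pos)
        (by exact_mod_cast Finset.card_image_le)).trans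
        (log_card_levelSets_le hdn hH hF hFne x t)
    refine (Finset.sum_le_sum fun σ _ => ?_).trans (sum_signs_sup_indicator_le hn 𝒜 hne hcard)
    refine Finset.sup'_le _ _ fun h hh => ?_
    have hmem : symmDiff (lev h) s ∈ 𝒜 :=
      Finset.mem_image_of_mem _ (Finset.mem_image_of_mem _ hh)
    refine le_trans (le_of_eq ?_) (Finset.le_sup' _ hmem)
    refine Finset.sum_congr rfl fun i _ => ?_
    congr 1
    simp only [hD, hlev, hs, Finset.mem_symmDiff, Finset.mem_filter, Finset.mem_univ, true_and]
    by_cases p : t < (h (x i) : ℝ) <;> by_cases q : t < (ψ (x i) : ℝ) <;> simp [p, q]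
  calc _ ≤ ∑ σ : Fin n → Bool, ∫ t in Set.Ioc (0 : ℝ) 1, G σ t :=
        Finset.sum_le_sum fun σ _ => h1 σ
    _ = ∫ t in Set.Ioc (0 : ℝ) 1, ∑ σ : Fin n → Bool, G σ t :=
        (integral_finsetSum _ fun σ _ => hGi σ).symm
    _ ≤ ∫ _t in Set.Ioc (0 : ℝ) 1, R :=
        integral_mono (integrable_finsetSum _ fun σ _ => hGi σ) (integrable_const _) h3
    _ = R := by simp

/-! ### The largest deviation and symmetrization -/

theorem measurable_finset_sup' {Y κ : Type*} [MeasurableSpace Y] {F : Finset κ} (hF : F.Nonempty)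
    {f : κ → Y → ℝ} (hf : ∀ k ∈ F, Measurable (f k)) :
    Measurable fun y => F.sup' hF fun k => f k y := by
  have h := Finset.measurable_sup' hF hf
  convert h using 1
  ext y; simp [Finset.sup'_apply]

theorem abs_sup'_le {κ : Type*} {F : Finset κ} (hF : F.Nonempty) {f : κ → ℝ} {B : ℝ}
    (hf : ∀ k ∈ F, |f k| ≤ B) : |F.sup' hF f| ≤ B := by
  obtain ⟨k, hk, h⟩ := Finset.exists_mem_eq_sup' hF f
  rw [h]; exact hf k hk

theorem abs_sum_le_of_abs_le_one {n : ℕ} {a : Fin n → ℝ} (ha : ∀ i, |a i| ≤ 1) :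
    |∑ i, a i| ≤ n :=
  (Finset.abs_sum_le_sum_abs _ _).trans <| (Finset.sum_le_sum fun i _ => ha i).trans (by simp)

theorem abs_sub_le_one {a b : ℝ} (ha : a ∈ Set.Icc (0 : ℝ) 1) (hb : b ∈ Set.Icc (0 : ℝ) 1) :
    |a - b| ≤ 1 := by
  rw [abs_le]; constructor <;> linarith [ha.1, ha.2, hb.1, hb.2]

theorem integrable_of_mem_unit {Y : Type*} [MeasurableSpace Y] {μ : Measure Y} [IsFiniteMeasure μ]
    {f : Y → ℝ} (hf : Measurable f) (h : ∀ y, f y ∈ Set.Icc (0 : ℝ) 1) : Integrable f μ :=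
  integrable_of_abs_le hf (B := 1) fun y => by rw [abs_of_nonneg (h y).1]; exact (h y).2

theorem integral_mem_unit {Y : Type*} [MeasurableSpace Y] {μ : Measure Y} [IsProbabilityMeasure μ]
    {f : Y → ℝ} (hf : Measurable f) (h : ∀ y, f y ∈ Set.Icc (0 : ℝ) 1) :
    ∫ y, f y ∂μ ∈ Set.Icc (0 : ℝ) 1 := by
  refine ⟨integral_nonneg fun y => (h y).1, ?_⟩
  have := integral_mono (integrable_of_mem_unit hf h) (integrable_const (μ := μ) (1 : ℝ))
    fun y => (h y).2
  simpa using this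

section Deviation

variable {X κ : Type*} [MeasurableSpace X] {n : ℕ} (μ : Fin n → Measure X)
  {F : Finset κ} (hF : F.Nonempty) {l : κ → X → ℝ}

/-- The largest deviation, over a finite class, of a sum of means from the sum over a sample. -/
noncomputable def supDeviation (l : κ → X → ℝ) (x : Fin n → X) : ℝ :=
  F.sup' hF fun k => ∑ i, (∫ a, l k a ∂μ i - l k (x i))

theorem measurable_supDeviation (hl : ∀ k ∈ F, Measurable (l k)) :
    Measurable (supDeviation μ hF l) :=
  measurable_finset_sup' hF fun k hk => Finset.measurable_fun_sum _ fun i _ =>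
    measurable_const.sub ((hl k hk).comp (measurable_pi_apply i))

theorem abs_supDeviation_le [∀ i, IsProbabilityMeasure (μ i)] (hl : ∀ k ∈ F, Measurable (l k))
    (hl1 : ∀ k x, l k x ∈ Set.Icc (0 : ℝ) 1) (x : Fin n → X) : |supDeviation μ hF l x| ≤ n :=
  abs_sup'_le hF fun k hk => abs_sum_le_of_abs_le_one fun _ =>
    abs_sub_le_one (integral_mem_unit (hl k hk) (hl1 k)) (hl1 k _)

theorem supDeviation_update_le (hl1 : ∀ k x, l k x ∈ Set.Icc (0 : ℝ) 1) (x : Fin n → X)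
    (i : Fin n) (a : X) :
    supDeviation μ hF l (Function.update x i a) ≤ supDeviation μ hF l x + 1 := by
  refine Finset.sup'_le _ _ fun k hk => ?_
  have h := Finset.le_sup' (fun k => ∑ i, (∫ a, l k a ∂μ i - l k (x i))) hk
  refine le_trans ?_ (add_le_add_left h 1)
  have h1 : (1 : ℝ) = ∑ j, if j = i then (1 : ℝ) else 0 := by simp
  rw [h1, ← Finset.sum_add_distrib]
  refine Finset.sum_le_sum fun j _ => ?_
  by_cases hj : j = i
  · subst hj
    simp only [Function.update_self, if_true]
    linarith [(hl1 k a).1, (hl1 k (x j)).2]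
  · simp [hj]

/-- The mean of the largest deviation, by symmetrization. -/
theorem integral_supDeviation_le [∀ i, IsProbabilityMeasure (μ i)] (hl : ∀ k ∈ F, Measurable (l k))
    (hl1 : ∀ k x, l k x ∈ Set.Icc (0 : ℝ) 1) {R : ℝ}
    (hR : ∀ x : Fin n → X, ∑ σ : Fin n → Bool,
      F.sup' hF (fun k => ∑ i, boolSign (σ i) * l k (x i)) ≤ 2 ^ n * R) :
    ∫ x, supDeviation μ hF l x ∂Measure.pi μ ≤ 2 * R := by
  set ν := Measure.pi fun i => (μ i).prod (μ i) with hν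
  set Φ : (Fin n → Bool) → (Fin n → X × X) → ℝ := fun σ z =>
    F.sup' hF fun k => ∑ i, boolSign (σ i) * (l k (z i).2 - l k (z i).1) with hΦ
  have hΦm (σ) : Measurable (Φ σ) :=
    measurable_finset_sup' hF fun k hk => Finset.measurable_fun_sum _ fun i _ =>
      (((hl k hk).comp (measurable_snd.comp (measurable_pi_apply i))).sub
        ((hl k hk).comp (measurable_fst.comp (measurable_pi_apply i)))).const_mul _
  have hΦb (σ z) : |Φ σ z| ≤ n :=
    abs_sup'_le hF fun k _ => abs_sum_le_of_abs_le_one fun i => by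
      rw [abs_mul, abs_boolSign, one_mul]; exact abs_sub_le_one (hl1 _ _) (hl1 _ _)
  have hΦi (σ) : Integrable (Φ σ) ν := integrable_of_abs_le (hΦm σ) (hΦb σ)
  -- Each mean is written as an average over an independent ghost sample, and the supremum is moved
  -- inside that average.
  have hghost : ∫ x, supDeviation μ hF l x ∂Measure.pi μ ≤ ∫ z, Φ (fun _ => true) z ∂ν := by
    set Ψ : (Fin n → X) × (Fin n → X) → ℝ := fun w =>
      F.sup' hF fun k => ∑ i, (l k (w.2 i) - l k (w.1 i)) with hΨ
    have hΨm : Measurable Ψ :=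
      measurable_finset_sup' hF fun k hk => Finset.measurable_fun_sum _ fun i _ =>
        ((hl k hk).comp ((measurable_pi_apply i).comp measurable_snd)).sub
          ((hl k hk).comp ((measurable_pi_apply i).comp measurable_fst))
    have hΨb (w) : |Ψ w| ≤ n :=
      abs_sup'_le hF fun k _ => abs_sum_le_of_abs_le_one fun i =>
        abs_sub_le_one (hl1 _ _) (hl1 _ _)
    have hmp := measurePreserving_arrowProdEquivProdArrow X X (Fin n) μ μ
    have h1 : ∫ z, Φ (fun _ => true) z ∂ν = ∫ w, Ψ w ∂(Measure.pi μ).prod (Measure.pi μ) := by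
      rw [← hmp.integral_comp (MeasurableEquiv.measurableEmbedding _) Ψ]
      refine integral_congr_ae (ae_of_all _ fun z => ?_)
      simp only [hΦ, hΨ, boolSign, if_true, one_mul]
      rfl
    have hΨi : Integrable Ψ ((Measure.pi μ).prod (Measure.pi μ)) := integrable_of_abs_le hΨm hΨb
    rw [h1, integral_prod _ hΨi]
    refine integral_mono (integrable_of_abs_le (measurable_supDeviation μ hF hl)
      (abs_supDeviation_le μ hF hl hl1)) hΨi.integral_prod_left fun x => ?_
    refine Finset.sup'_le _ _ fun k hk => ?_
    have hki (i) : Integrable (fun y : Fin n → X => l k (y i)) (Measure.pi μ) :=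
      integrable_of_mem_unit ((hl k hk).comp (measurable_pi_apply i)) fun y => hl1 _ _
    have hkd (i) : Integrable (fun y : Fin n → X => l k (y i) - l k (x i)) (Measure.pi μ) :=
      (hki i).sub (integrable_const _)
    have h2 : ∑ i, (∫ a, l k a ∂μ i - l k (x i))
        = ∫ y, ∑ i, (l k (y i) - l k (x i)) ∂Measure.pi μ := by
      rw [integral_finsetSum _ fun i _ => hkd i]
      refine Finset.sum_congr rfl fun i _ => ?_
      rw [integral_sub (hki i) (integrable_const _),
        integral_comp_eval (μ := μ) (hl k hk).aestronglyMeasurable]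
      simp
    rw [h2]
    refine integral_mono (integrable_finsetSum _ fun i _ => hkd i)
      (integrable_of_abs_le (hΨm.comp measurable_prodMk_left) fun y => hΨb _) fun y => ?_
    exact Finset.le_sup' (fun k => ∑ i, (l k (y i) - l k (x i))) hk
  -- Both entries of the pair `z i` have law `μ i`, so swapping them where `σ i` is false preserves
  -- `ν`. The laws may differ from one index to another.
  have hswap (σ : Fin n → Bool) : ∫ z, Φ (fun _ => true) z ∂ν = ∫ z, Φ σ z ∂ν := by
    have hmp := measurePreserving_pi (fun i => (μ i).prod (μ i)) (fun i => (μ i).prod (μ i))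
      (f := fun i => if σ i then id else Prod.swap) fun i => by
        split_ifs
        · exact MeasurePreserving.id _
        · exact Measure.measurePreserving_swap
    rw [← hν] at hmp
    conv_lhs => rw [← hmp.map_eq]
    rw [integral_map hmp.measurable.aemeasurable (hΦm _).aestronglyMeasurable]
    refine integral_congr_ae (ae_of_all _ fun z => ?_)
    simp only [hΦ]
    refine Finset.sup'_congr _ rfl fun k _ => Finset.sum_congr rfl fun i _ => ?_
    cases σ i <;> simp [boolSign]
  -- Sample and ghost sample each contribute one Rademacher average; the flipped signs of one of
  -- them disappear on reindexing.
  have hpt (z : Fin n → X × X) : ∑ σ, Φ σ z ≤ 2 ^ n * R + 2 ^ n * R := by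
    have h1 (σ : Fin n → Bool) : Φ σ z ≤
        F.sup' hF (fun k => ∑ i, boolSign (σ i) * l k (z i).2) +
        F.sup' hF (fun k => ∑ i, boolSign (!σ i) * l k (z i).1) := by
      refine Finset.sup'_le _ _ fun k hk => ?_
      have e : ∑ i, boolSign (σ i) * (l k (z i).2 - l k (z i).1)
          = ∑ i, boolSign (σ i) * l k (z i).2 + ∑ i, boolSign (!σ i) * l k (z i).1 := by
        rw [← Finset.sum_add_distrib]
        exact Finset.sum_congr rfl fun i _ => by rw [boolSign_not]; ring
      rw [e]
      exact add_le_add (Finset.le_sup' (fun k => ∑ i, boolSign (σ i) * l k (z i).2) hk)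
        (Finset.le_sup' (fun k => ∑ i, boolSign (!σ i) * l k (z i).1) hk)
    refine (Finset.sum_le_sum fun σ _ => h1 σ).trans ?_
    rw [Finset.sum_add_distrib, sum_signs_comp_not fun σ : Fin n → Bool =>
      F.sup' hF fun k => ∑ i, boolSign (σ i) * l k (z i).1]
    exact add_le_add (hR fun i => (z i).2) (hR fun i => (z i).1)
  have hfin : 2 ^ n * ∫ z, Φ (fun _ => true) z ∂ν ≤ 2 ^ n * R + 2 ^ n * R := by
    calc 2 ^ n * ∫ z, Φ (fun _ => true) z ∂ν
        = ∑ _σ : Fin n → Bool, ∫ z, Φ (fun _ => true) z ∂ν := by simp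
      _ = ∑ σ : Fin n → Bool, ∫ z, Φ σ z ∂ν := Finset.sum_congr rfl fun σ _ => hswap σ
      _ = ∫ z, ∑ σ : Fin n → Bool, Φ σ z ∂ν := (integral_finsetSum _ fun σ _ => hΦi σ).symm
      _ ≤ ∫ _z, (2 ^ n * R + 2 ^ n * R) ∂ν :=
          integral_mono (integrable_finsetSum _ fun σ _ => hΦi σ) (integrable_const _) hpt
      _ = 2 ^ n * R + 2 ^ n * R := by simp
  have hp : (0 : ℝ) < 2 ^ n := by positivity
  refine hghost.trans (le_of_mul_le_mul_left ?_ hp)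
  linarith

end Deviation

/-! ### The deviation bound for finite classes -/

theorem absLoss_mem_unit (a b : unitInterval) : |(a : ℝ) - b| ∈ Set.Icc (0 : ℝ) 1 :=
  ⟨abs_nonneg _, abs_sub_le_one a.2 b.2⟩

theorem measurable_absLoss {X : Type*} [MeasurableSpace X] {h ψ : X → unitInterval}
    (hh : Measurable h) (hψ : Measurable ψ) : Measurable fun x => |(h x : ℝ) - ψ x| :=
  continuous_abs.measurable.comp (hh.subtype_val.sub hψ.subtype_val)

/-- The deviation term of the generalization bound. -/
noncomputable def deviationBound (n d : ℕ) (δ : ℝ) : ℝ :=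
  Real.sqrt (4 * (d : ℝ) / n * Real.log (Real.exp 1 * n / d) + 1 / n * Real.log (1 / δ))

/-- The tail of the largest deviation for a finite subclass of a class of bounded
pseudo-dimension. -/
theorem measureReal_supDeviation_gt_le {X : Type*} [MeasurableSpace X] {n d : ℕ} (hn : 0 < n)
    (hdn : d ≤ n) (μ : Fin n → Measure X) [∀ i, IsProbabilityMeasure (μ i)]
    {H : Set (X → unitInterval)} (hH : ∀ s : Finset X, PseudoShatters H s → s.card ≤ d)
    {F : Finset (X → unitInterval)} (hFH : ↑F ⊆ H) (hF : F.Nonempty)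
    (hFm : ∀ h ∈ F, Measurable h) {ψ : X → unitInterval} (hψ : Measurable ψ)
    {δ : ℝ} (hδ0 : 0 < δ) (hδ1 : δ ≤ 1) :
    (Measure.pi μ).real
      {x | n * deviationBound n d δ <
        supDeviation μ hF (fun (h : X → unitInterval) x => |(h x : ℝ) - ψ x|) x} ≤ δ := by
  have hn' : (0 : ℝ) < n := by exact_mod_cast hn
  set l : (X → unitInterval) → X → ℝ := fun h x => |(h x : ℝ) - ψ x| with hl
  have hlm : ∀ h ∈ F, Measurable (l h) := fun h hh => measurable_absLoss (hFm h hh) hψ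
  have hl1 (h x) : l h x ∈ Set.Icc (0 : ℝ) 1 := absLoss_mem_unit _ _
  set K := d * Real.log (Real.exp 1 * n / d) with hK
  have hK0 : 0 ≤ K := by
    rcases Nat.eq_zero_or_pos d with rfl | hd
    · simp [hK]
    · have hd' : (0 : ℝ) < d := by exact_mod_cast hd
      have hdn' : (d : ℝ) ≤ n := by exact_mod_cast hdn
      refine mul_nonneg hd'.le (Real.log_nonneg ?_)
      rw [le_div_iff₀ hd', one_mul]
      have := Real.add_one_le_exp (1 : ℝ)
      nlinarith
  have hmean := integral_supDeviation_le μ hF hlm hl1 fun x =>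
    sum_signs_sup_loss_le hn hdn hH hFH hF ψ x
  rw [← hK] at hmean
  set m := ∫ x, supDeviation μ hF l x ∂Measure.pi μ with hm
  set J := Real.log (1 / δ) with hJ
  have hJ0 : 0 ≤ J := Real.log_nonneg (by rw [le_div_iff₀ hδ0]; linarith)
  set ε := Real.sqrt (n * J / 2) with hε
  have htail := measureReal_boundedDifferences_le μ (measurable_supDeviation μ hF hlm)
    -- The choice of `ε` makes the McDiarmid tail exactly `δ`.
    (abs_supDeviation_le μ hF hlm hl1) (supDeviation_update_le μ hF hl1)
    (Real.sqrt_nonneg _ : 0 ≤ ε)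
  have hexp : Real.exp (-2 * ε ^ 2 / n) = δ := by
    rw [hε, Real.sq_sqrt (by positivity)]
    have : -2 * (n * J / 2) / n = Real.log δ := by
      rw [hJ, one_div, Real.log_inv]; field_simp
    rw [this, Real.exp_log hδ0]
  rw [hexp] at htail
  refine le_trans (measureReal_mono fun x hx => ?_) htail
  simp only [Set.mem_ofPred_eq] at hx ⊢
  -- By `(u + v) ^ 2 ≤ 2 * (u ^ 2 + v ^ 2)`, the square of the left side is at most `4 * n * K + n *
  -- J`; hence the constants 4 and 1 under the root.
  have hb : 2 * Real.sqrt (n * K / 2) + ε ≤ n * deviationBound n d δ := by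
    have e : n * deviationBound n d δ = Real.sqrt (n ^ 2 * (4 * K / n + 1 / n * J)) := by
      rw [Real.sqrt_mul (by positivity), Real.sqrt_sq hn'.le, deviationBound, hK, hJ]
      congr 2; ring
    rw [e]
    refine Real.le_sqrt_of_sq_le ?_
    have h1 := Real.sq_sqrt (show 0 ≤ n * K / 2 by positivity)
    have h2 : ε ^ 2 = n * J / 2 := Real.sq_sqrt (by positivity)
    have h3 : (n : ℝ) ^ 2 * (4 * K / n + 1 / n * J) = 4 * (n * K) + n * J := by
      field_simp
    rw [h3]
    nlinarith [sq_nonneg (2 * Real.sqrt (n * K / 2) - ε)]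
  linarith

/-! ### From finite classes to the whole hypothesis set -/

/-- Restricted to a countable dense set `D`, the class lies in the separable metrizable space
`[0,1]^D`, so it has a countable dense part. The common Lipschitz constant extends convergence from
`D` to `X`. -/
theorem exists_countable_pointwise_dense {X : Type*} [PseudoMetricSpace X]
    [TopologicalSpace.SeparableSpace X] {H : Set (X → unitInterval)} {L : ℝ≥0}
    (hL : ∀ h ∈ H, LipschitzWith L h) :
    ∃ C ⊆ H, C.Countable ∧ ∀ h ∈ H, ∃ u : ℕ → X → unitInterval, (∀ m, u m ∈ C) ∧
      ∀ x, Filter.Tendsto (fun m => u m x) Filter.atTop (nhds (h x)) := by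
  obtain ⟨D, hDc, hDd⟩ := TopologicalSpace.exists_countable_dense X
  have := hDc.to_subtype
  let r : H → D → unitInterval := fun h x => h.1 x
  obtain ⟨S, hSc, hSd⟩ := TopologicalSpace.exists_countable_dense (Set.range r)
  choose q hq using fun s : Set.range r => s.2
  refine ⟨(fun s => (q s).1) '' S, ?_, hSc.image _, fun h hh => ?_⟩
  · rintro _ ⟨s, -, rfl⟩
    exact (q s).2
  obtain ⟨v, hvS, hv⟩ := mem_closure_iff_seq_limit.1 (hSd ⟨r ⟨h, hh⟩, ⟨h, hh⟩, rfl⟩)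
  refine ⟨fun m => (q (v m)).1, fun m => ⟨v m, hvS m, rfl⟩, fun x => ?_⟩
  have hD (y : D) : Filter.Tendsto (fun m => (q (v m)).1 y) Filter.atTop (nhds (h y)) := by
    have h1 := (tendsto_pi_nhds.1 ((continuous_subtype_val.tendsto _).comp hv)) y
    refine h1.congr fun m => ?_
    exact (congrFun (hq (v m)) y).symm
  rw [Metric.tendsto_nhds]
  intro ε hε
  -- Dividing by `L + 1` covers `L = 0`.
  obtain ⟨y, hyD, hy⟩ := hDd.exists_dist_lt x (show 0 < ε / (3 * (L + 1)) by positivity)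
  have hLy : L * dist x y < ε / 3 := by
    calc (L : ℝ) * dist x y ≤ (L + 1) * dist x y := by gcongr; linarith
      _ < (L + 1) * (ε / (3 * (L + 1))) := by gcongr
      _ = ε / 3 := by field_simp
  filter_upwards [Metric.tendsto_nhds.1 (hD ⟨y, hyD⟩) (ε / 3) (by positivity)] with m hm
  have h1 := (hL _ (q (v m)).2).dist_le_mul x y
  have h2 := (hL _ hh).dist_le_mul y x
  rw [dist_comm y x] at h2
  have h3 := dist_triangle4 ((q (v m)).1 x) ((q (v m)).1 y) (h y) (h x)
  linarith

theorem risk_mem_unit {X : Type*} [MeasurableSpace X] (μ : Measure X) [IsProbabilityMeasure μ]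
    {ψ h : X → unitInterval} (hψ : Measurable ψ) (hh : Measurable h) :
    risk μ ψ h ∈ Set.Icc (0 : ℝ) 1 :=
  integral_mem_unit (measurable_absLoss hh hψ) fun _ => absLoss_mem_unit _ _

theorem tendsto_risk {X : Type*} [MeasurableSpace X] (μ : Measure X) [IsProbabilityMeasure μ]
    {ψ h : X → unitInterval} (hψ : Measurable ψ) {u : ℕ → X → unitInterval}
    (hu : ∀ m, Measurable (u m))
    (hlim : ∀ x, Filter.Tendsto (fun m => u m x) Filter.atTop (nhds (h x))) :
    Filter.Tendsto (fun m => risk μ ψ (u m)) Filter.atTop (nhds (risk μ ψ h)) := by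
  refine tendsto_integral_of_dominated_convergence (fun _ => 1)
    (fun m => (measurable_absLoss (hu m) hψ).aestronglyMeasurable) (integrable_const _)
    (fun m => ae_of_all _ fun x => ?_) (ae_of_all _ fun x => ?_)
  · rw [Real.norm_eq_abs, abs_abs]; exact (absLoss_mem_unit _ _).2
  · exact (((continuous_subtype_val.tendsto _).comp (hlim x)).sub_const _).abs

theorem tendsto_empiricalRisk {X : Type*} {n : ℕ} (x : Fin n → X) (ψ : X → unitInterval)
    {h : X → unitInterval} {u : ℕ → X → unitInterval}
    (hlim : ∀ x, Filter.Tendsto (fun m => u m x) Filter.atTop (nhds (h x))) :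
    Filter.Tendsto (fun m => empiricalRisk x ψ (u m)) Filter.atTop
      (nhds (empiricalRisk x ψ h)) :=
  (tendsto_finsetSum _ fun i _ =>
    (((continuous_subtype_val.tendsto _).comp (hlim (x i))).sub_const _).abs).const_mul _

section Sample

variable {X Ω : Type*} [MeasurableSpace X] [MeasurableSpace Ω] {P : Measure Ω}
  [IsProbabilityMeasure P] {n d : ℕ} {E : Fin n → Ω → X} {μ : Measure X}

theorem isProbabilityMeasure_of_average (hn : 0 < n) (hE : ∀ i, Measurable (E i))
    (hlaw : (n : ℝ≥0∞)⁻¹ • ∑ i, P.map (E i) = μ) : IsProbabilityMeasure μ := by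
  have hprob (i) : IsProbabilityMeasure (P.map (E i)) :=
    Measure.isProbabilityMeasure_map (hE i).aemeasurable
  refine ⟨?_⟩
  rw [← hlaw]
  simp only [Measure.smul_apply, Measure.finsetSum_apply, measure_univ, smul_eq_mul,
    Finset.sum_const, Finset.card_univ, Fintype.card_fin, nsmul_eq_mul, mul_one]
  exact ENNReal.inv_mul_cancel (by exact_mod_cast hn.ne') (ENNReal.natCast_ne_top n)

/-- Only the average of the laws is prescribed, so the deviation is measured from the sum of the
individual means, which is `n` times the risk. -/
theorem risk_eq_average (hE : ∀ i, Measurable (E i))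
    (hlaw : (n : ℝ≥0∞)⁻¹ • ∑ i, P.map (E i) = μ) {ψ h : X → unitInterval} (hψ : Measurable ψ)
    (hh : Measurable h) :
    risk μ ψ h = 1 / n * ∑ i, ∫ a, |(h a : ℝ) - ψ a| ∂P.map (E i) := by
  have hprob (i) : IsProbabilityMeasure (P.map (E i)) :=
    Measure.isProbabilityMeasure_map (hE i).aemeasurable
  rw [risk, ← hlaw, integral_smul_measure, integral_finsetSum_measure fun i _ =>
    integrable_of_mem_unit (measurable_absLoss hh hψ) fun _ => absLoss_mem_unit _ _]
  simp

/-- Uniform deviation over a finite class. -/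
theorem measure_exists_finset_risk_gt_le (hn : 0 < n) (hdn : d ≤ n) (hE : ∀ i, Measurable (E i))
    (hind : iIndepFun E P) (hlaw : (n : ℝ≥0∞)⁻¹ • ∑ i, P.map (E i) = μ)
    {H : Set (X → unitInterval)} (hH : ∀ s : Finset X, PseudoShatters H s → s.card ≤ d)
    {F : Finset (X → unitInterval)} (hFH : ↑F ⊆ H) (hF : F.Nonempty)
    (hFm : ∀ h ∈ F, Measurable h) {ψ : X → unitInterval} (hψ : Measurable ψ)
    {δ : ℝ} (hδ0 : 0 < δ) (hδ1 : δ ≤ 1) :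
    P {ω | ∃ h ∈ F, empiricalRisk (fun i => E i ω) ψ h + deviationBound n d δ < risk μ ψ h}
      ≤ ENNReal.ofReal δ := by
  have hn' : (0 : ℝ) < n := by exact_mod_cast hn
  have hprob (i) : IsProbabilityMeasure (P.map (E i)) :=
    Measure.isProbabilityMeasure_map (hE i).aemeasurable
  have hmap := (iIndepFun_iff_map_fun_eq_pi_map fun i => (hE i).aemeasurable).1 hind
  have hEm : Measurable fun ω i => E i ω := measurable_pi_iff.2 hE
  have htail := measureReal_supDeviation_gt_le hn hdn (fun i => P.map (E i)) hH hFH hF hFm hψ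
    hδ0 hδ1
  have hms : MeasurableSet {x | n * deviationBound n d δ < supDeviation (fun i => P.map (E i)) hF
      (fun (h : X → unitInterval) x => |(h x : ℝ) - ψ x|) x} :=
    measurableSet_lt measurable_const
      (measurable_supDeviation _ hF fun h hh => measurable_absLoss (hFm h hh) hψ)
  rw [← hmap, measureReal_def, Measure.map_apply hEm hms] at htail
  rw [← ENNReal.ofReal_toReal (measure_ne_top P _)]
  refine ENNReal.ofReal_le_ofReal (le_trans (ENNReal.toReal_mono (measure_ne_top P _)
    (measure_mono ?_)) htail)
  rintro ω ⟨h, hh, hlt⟩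
  simp only [Set.mem_preimage, Set.mem_ofPred_eq]
  refine lt_of_lt_of_le ?_ (Finset.le_sup' (fun h : X → unitInterval =>
    ∑ i, (∫ a, |(h a : ℝ) - ψ a| ∂P.map (E i) - |(h (E i ω) : ℝ) - ψ (E i ω)|)) hh)
  rw [risk_eq_average hE hlaw hψ (hFm h hh), empiricalRisk] at hlt
  rw [Finset.sum_sub_distrib, lt_sub_iff_add_lt]
  have h2 := mul_lt_mul_of_pos_left hlt hn'
  rw [mul_add, ← mul_assoc, ← mul_assoc, mul_one_div_cancel hn'.ne', one_mul, one_mul] at h2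
  linarith

theorem measurable_empiricalRisk (hE : ∀ i, Measurable (E i)) {ψ h : X → unitInterval}
    (hψ : Measurable ψ) (hh : Measurable h) :
    Measurable fun ω => empiricalRisk (fun i => E i ω) ψ h :=
  (Finset.measurable_fun_sum _ fun i _ =>
    (measurable_absLoss hh hψ).comp (hE i)).const_mul _

/-- Uniform deviation over a countable class. -/
theorem measure_exists_countable_risk_gt_le (hn : 0 < n) (hdn : d ≤ n)
    (hE : ∀ i, Measurable (E i)) (hind : iIndepFun E P)
    (hlaw : (n : ℝ≥0∞)⁻¹ • ∑ i, P.map (E i) = μ)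
    {H : Set (X → unitInterval)} (hH : ∀ s : Finset X, PseudoShatters H s → s.card ≤ d)
    (hHm : ∀ h ∈ H, Measurable h) {C : Set (X → unitInterval)} (hCH : C ⊆ H) (hC : C.Countable)
    {ψ : X → unitInterval} (hψ : Measurable ψ) {δ : ℝ} (hδ0 : 0 < δ) (hδ1 : δ ≤ 1) :
    P {ω | ∃ h ∈ C, empiricalRisk (fun i => E i ω) ψ h + deviationBound n d δ < risk μ ψ h}
      ≤ ENNReal.ofReal δ := by
  classical
  rcases C.eq_empty_or_nonempty with rfl | hne
  · simp
  obtain ⟨w, rfl⟩ := hC.exists_eq_range hne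
  set s : ℕ → Set Ω := fun m =>
    {ω | empiricalRisk (fun i => E i ω) ψ (w m) + deviationBound n d δ < risk μ ψ (w m)} with hs
  have h1 : {ω | ∃ h ∈ Set.range w,
      empiricalRisk (fun i => E i ω) ψ h + deviationBound n d δ < risk μ ψ h} = ⋃ m, s m := by
    ext ω; simp [hs]
  -- Continuity from below: each partial union concerns a finite class, and the bound `δ` is the
  -- same for all of them.
  rw [h1, measure_iUnion_eq_iSup_accumulate]
  refine iSup_le fun m => ?_
  have hsub : ↑((Finset.range (m + 1)).image w) ⊆ H := by
    intro h hh
    obtain ⟨j, -, rfl⟩ := Finset.mem_image.1 (Finset.mem_coe.1 hh)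
    exact hCH ⟨j, rfl⟩
  refine (measure_mono ?_).trans (measure_exists_finset_risk_gt_le hn hdn hE hind hlaw hH hsub
    ((Finset.nonempty_range_iff.2 m.succ_ne_zero).image w) (fun h hh => hHm h (hsub hh)) hψ
    hδ0 hδ1)
  intro ω hω
  obtain ⟨j, hj, hω⟩ := Set.mem_accumulate.1 hω
  exact ⟨w j, Finset.mem_image_of_mem _ (Finset.mem_range.2 (Nat.lt_succ_of_le hj)), hω⟩

end Sample

/-- Uniform deviation over a class of Lipschitz functions. -/
theorem exists_measurableSet_forall_risk_le {X Ω : Type*} [PseudoMetricSpace X]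
    [TopologicalSpace.SeparableSpace X] [MeasurableSpace X] [BorelSpace X] [MeasurableSpace Ω]
    {P : Measure Ω} [IsProbabilityMeasure P] {n d : ℕ} {E : Fin n → Ω → X} {μ : Measure X}
    (hn : 0 < n) (hdn : d ≤ n) (hE : ∀ i, Measurable (E i)) (hind : iIndepFun E P)
    (hlaw : (n : ℝ≥0∞)⁻¹ • ∑ i, P.map (E i) = μ)
    {H : Set (X → unitInterval)} (hH : ∀ s : Finset X, PseudoShatters H s → s.card ≤ d)
    {L : ℝ≥0} (hL : ∀ h ∈ H, LipschitzWith L h)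
    {ψ : X → unitInterval} (hψ : Measurable ψ) {δ : ℝ} (hδ0 : 0 < δ) (hδ1 : δ ≤ 1) :
    ∃ A : Set Ω, MeasurableSet A ∧ ENNReal.ofReal (1 - δ) ≤ P A ∧ ∀ ω ∈ A, ∀ h ∈ H,
      risk μ ψ h ≤ empiricalRisk (fun i => E i ω) ψ h + deviationBound n d δ := by
  have := isProbabilityMeasure_of_average hn hE hlaw
  have hHm (h) (hh : h ∈ H) : Measurable h := (hL h hh).continuous.measurable
  obtain ⟨C, hCH, hCc, hCd⟩ := exists_countable_pointwise_dense hL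
  have hbad := measure_exists_countable_risk_gt_le hn hdn hE hind hlaw hH hHm hCH hCc hψ hδ0 hδ1
  set bad := {ω | ∃ h ∈ C, empiricalRisk (fun i => E i ω) ψ h + deviationBound n d δ < risk μ ψ h}
    with hbad_def
  have hm : MeasurableSet bad := by
    have : bad = ⋃ h ∈ C,
        {ω | empiricalRisk (fun i => E i ω) ψ h + deviationBound n d δ < risk μ ψ h} := by
      ext ω; simp [hbad_def]
    rw [this]
    exact MeasurableSet.biUnion hCc fun h hh => measurableSet_lt
      ((measurable_empiricalRisk hE hψ (hHm h (hCH hh))).add_const _) measurable_const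
  refine ⟨badᶜ, hm.compl, ?_, fun ω hω h hh => ?_⟩
  · rw [prob_compl_eq_one_sub hm, ENNReal.ofReal_sub _ hδ0.le, ENNReal.ofReal_one]
    exact tsub_le_tsub_left hbad 1
  · obtain ⟨u, huC, hu⟩ := hCd h hh
    refine le_of_tendsto_of_tendsto' (tendsto_risk μ hψ (fun m => hHm _ (hCH (huC m))) hu)
      ((tendsto_empiricalRisk (fun i => E i ω) ψ hu).add_const _) fun m => ?_
    exact not_lt.1 fun hlt => hω ⟨u m, huC m, hlt⟩

/-! ### Change of domain -/

/-- The easy half of Kantorovich duality: integrate the Lipschitz inequality against each coupling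
and take the infimum; no optimal coupling is needed. -/
theorem lintegral_le_add_wassersteinOne {X : Type*} [PseudoMetricSpace X] [MeasurableSpace X]
    (μ ν : Measure X) [IsProbabilityMeasure μ]
    [IsProbabilityMeasure ν] {f : X → ℝ} (hf : Measurable f) {K : ℝ≥0}
    (hK : ∀ x y, f y ≤ f x + K * dist x y) :
    ∫⁻ x, ENNReal.ofReal (f x) ∂ν
      ≤ ∫⁻ x, ENNReal.ofReal (f x) ∂μ + K * wassersteinOne μ ν := by
  have hof : Measurable fun x => ENNReal.ofReal (f x) := hf.ennreal_ofReal
  have hγ (γ : Measure (X × X)) (h1 : γ.map Prod.fst = μ) (h2 : γ.map Prod.snd = ν) :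
      ∫⁻ x, ENNReal.ofReal (f x) ∂ν
        ≤ ∫⁻ x, ENNReal.ofReal (f x) ∂μ + K * ∫⁻ z, edist z.1 z.2 ∂γ := by
    rw [← h1, ← h2, lintegral_map hof measurable_fst, lintegral_map hof measurable_snd,
      ← lintegral_const_mul' _ _ ENNReal.coe_ne_top,
      ← lintegral_add_left (f := fun z : X × X => ENNReal.ofReal (f z.1)) (hof.comp measurable_fst)]
    refine lintegral_mono fun z => ?_
    calc ENNReal.ofReal (f z.2) ≤ ENNReal.ofReal (f z.1 + K * dist z.1 z.2) :=
          ENNReal.ofReal_le_ofReal (hK _ _)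
      _ ≤ ENNReal.ofReal (f z.1) + ENNReal.ofReal (K * dist z.1 z.2) := ENNReal.ofReal_add_le
      _ = _ := by
          rw [ENNReal.ofReal_mul (NNReal.coe_nonneg K), edist_dist, ENNReal.ofReal_coe_nnreal]
  -- The distance may be infinite, and `0 * ⊤ = 0` does not pass through the infimum; for `K = 0`
  -- the product coupling suffices.
  rcases eq_or_ne K 0 with rfl | hK0
  · have := hγ (μ.prod ν) (by simp) (by simp)
    simpa using this
  · have hK0' : (K : ℝ≥0∞) ≠ 0 := by exact_mod_cast hK0
    rw [wassersteinOne, ENNReal.mul_iInf_of_ne hK0' ENNReal.coe_ne_top, ENNReal.add_iInf]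
    refine le_iInf fun γ => ?_
    by_cases h : γ.map Prod.fst = μ ∧ γ.map Prod.snd = ν
    · rw [iInf_pos h]
      exact hγ γ h.1 h.2
    · rw [iInf_neg h, ENNReal.mul_top hK0', add_top]
      exact le_top

theorem ofReal_risk_eq_lintegral {X : Type*} [MeasurableSpace X] (μ : Measure X)
    [IsProbabilityMeasure μ] {ψ h : X → unitInterval} (hψ : Measurable ψ) (hh : Measurable h) :
    ENNReal.ofReal (risk μ ψ h) = ∫⁻ x, ENNReal.ofReal |(h x : ℝ) - ψ x| ∂μ :=
  ofReal_integral_eq_lintegral_ofReal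
    (integrable_of_mem_unit (measurable_absLoss hh hψ) fun _ => absLoss_mem_unit _ _)
    (ae_of_all _ fun _ => abs_nonneg _)

theorem risk_triangle {X : Type*} [MeasurableSpace X] (μ : Measure X) [IsProbabilityMeasure μ]
    {ψ h g : X → unitInterval} (hψ : Measurable ψ) (hh : Measurable h) (hg : Measurable g) :
    risk μ ψ h ≤ risk μ g h + risk μ ψ g := by
  have hi {a b : X → unitInterval} (ha : Measurable a) (hb : Measurable b) :
      Integrable (fun x => |(a x : ℝ) - b x|) μ :=
    integrable_of_mem_unit (measurable_absLoss ha hb) fun _ => absLoss_mem_unit _ _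
  rw [risk, risk, risk, ← integral_add (hi hh hg) (hi hg hψ)]
  exact integral_mono (hi hh hψ) ((hi hh hg).add (hi hg hψ)) fun x => abs_sub_le _ _ _

theorem risk_comm {X : Type*} [MeasurableSpace X] (μ : Measure X) (h g : X → unitInterval) :
    risk μ h g = risk μ g h := by
  simp only [risk, abs_sub_comm]

section Transport

variable {X : Type*} [PseudoMetricSpace X] [MeasurableSpace X]
  [BorelSpace X]

/-- The disagreement of two Lipschitz hypotheses under a change of domain. -/
theorem risk_le_risk_add_wassersteinOne (μ ν : Measure X) [IsProbabilityMeasure μ]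
    [IsProbabilityMeasure ν] {L : ℝ≥0} {h g : X → unitInterval} (hh : LipschitzWith L h)
    (hg : LipschitzWith L g) :
    ENNReal.ofReal (risk ν g h)
      ≤ ENNReal.ofReal (risk μ g h) + 2 * (L : ℝ≥0∞) * wassersteinOne μ ν := by
  have hhm := hh.continuous.measurable
  have hgm := hg.continuous.measurable
  rw [ofReal_risk_eq_lintegral _ hgm hhm, ofReal_risk_eq_lintegral _ hgm hhm]
  have := lintegral_le_add_wassersteinOne μ ν (measurable_absLoss hhm hgm) (K := 2 * L)
    fun x y => by
      have h1 := hh.dist_le_mul y x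
      have h2 := hg.dist_le_mul x y
      rw [dist_comm y x, Subtype.dist_eq, Real.dist_eq] at h1
      rw [Subtype.dist_eq, Real.dist_eq] at h2
      have h3 := abs_sub_le (h y : ℝ) (h x) (g y)
      have h4 := abs_sub_le (h x : ℝ) (g x) (g y)
      push_cast
      linarith
  simpa using this

/-- The error on the target domain is at most that on the source domain, the joint error of the
class and a transport term. -/
theorem risk_target_le (μ ν : Measure X) [IsProbabilityMeasure μ] [IsProbabilityMeasure ν]
    {ψ φ : X → unitInterval} (hψ : Measurable ψ) (hφ : Measurable φ) {L : ℝ≥0}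
    {H : Set (X → unitInterval)} (hL : ∀ h ∈ H, LipschitzWith L h) {h : X → unitInterval}
    (hh : h ∈ H) :
    ENNReal.ofReal (risk ν φ h) ≤ ENNReal.ofReal (risk μ ψ h) +
      ENNReal.ofReal (jointError μ ν ψ φ H) + 2 * (L : ℝ≥0∞) * wassersteinOne μ ν := by
  have hm (g : H) : Measurable g.1 := (hL g.1 g.2).continuous.measurable
  set W := 2 * (L : ℝ≥0∞) * wassersteinOne μ ν with hW
  rcases eq_or_ne W ⊤ with hWt | hWt
  · simp [hWt]
  have hreal (g : H) : risk ν φ h ≤ risk μ ψ h + (risk μ ψ g + risk ν φ g) + W.toReal := by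
    have h1 := risk_triangle ν hφ (hm ⟨h, hh⟩) (hm g)
    have h2 := risk_triangle μ (hm g) (hm ⟨h, hh⟩) hψ
    rw [risk_comm μ g.1 ψ] at h2
    have h3 := risk_le_risk_add_wassersteinOne μ ν (hL h hh) (hL g.1 g.2)
    have h4 : risk ν g h ≤ risk μ g h + W.toReal := by
      rw [← hW, ← ENNReal.ofReal_toReal hWt, ← ENNReal.ofReal_add
        (risk_mem_unit μ (hm g) (hm ⟨h, hh⟩)).1 ENNReal.toReal_nonneg] at h3
      exact (ENNReal.ofReal_le_ofReal_iff (add_nonneg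
        (risk_mem_unit μ (hm g) (hm ⟨h, hh⟩)).1 ENNReal.toReal_nonneg)).1 h3
    linarith
  have : Nonempty H := ⟨⟨h, hh⟩⟩
  have hinf : risk ν φ h - risk μ ψ h - W.toReal ≤ jointError μ ν ψ φ H :=
    le_ciInf fun g => by linarith [hreal g]
  rw [← ENNReal.ofReal_toReal hWt]
  calc _ ≤ ENNReal.ofReal (risk μ ψ h + jointError μ ν ψ φ H + W.toReal) :=
        ENNReal.ofReal_le_ofReal (by linarith)
    _ ≤ _ := ENNReal.ofReal_add_le.trans (by gcongr; exact ENNReal.ofReal_add_le)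

end Transport

/-! ### The remaining range of `d` and the conclusion -/

theorem card_le_of_pseudoDim_eq {X : Type*} {H : Set (X → unitInterval)} {d : ℕ}
    (hd : pseudoDim H = d) (s : Finset X) (hs : PseudoShatters H s) : s.card ≤ d := by
  have h : (s.card : ℕ∞) ≤ pseudoDim H :=
    le_iSup₂_of_le (f := fun (s : Finset X) (_ : PseudoShatters H s) => (s.card : ℕ∞)) s hs le_rfl
  rw [hd] at h
  exact_mod_cast h

theorem one_le_deviationBound {n d : ℕ} (hn : 0 < n) (hnd : n ≤ d) (hdn : d ≤ 2 * n) {δ : ℝ}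
    (hδ0 : 0 < δ) (hδ1 : δ ≤ 1) : 1 ≤ deviationBound n d δ := by
  have hn' : (0 : ℝ) < n := by exact_mod_cast hn
  have hd' : (0 : ℝ) < d := by exact_mod_cast hn.trans_le hnd
  have hdn' : (d : ℝ) ≤ 2 * n := by exact_mod_cast hdn
  have hnd' : (n : ℝ) ≤ d := by exact_mod_cast hnd
  have hJ0 : 0 ≤ 1 / (n : ℝ) * Real.log (1 / δ) :=
    mul_nonneg (by positivity) (Real.log_nonneg (by rw [le_div_iff₀ hδ0]; linarith))
  -- From `d ≤ 2 * n` the logarithm is at least `1 - log 2 > 1 / 4`, and `n ≤ d` makes its factor at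
  -- least 4.
  have h1 : 1 / 4 ≤ Real.log (Real.exp 1 * n / d) := by
    have h2 : Real.log (Real.exp 1 / 2) ≤ Real.log (Real.exp 1 * n / d) := by
      refine Real.log_le_log (by positivity) ?_
      rw [div_le_div_iff₀ two_pos hd']
      nlinarith [Real.exp_pos 1]
    rw [Real.log_div (Real.exp_pos 1).ne' two_ne_zero, Real.log_exp] at h2
    linarith [Real.log_two_lt_d9]
  have h3 : 4 ≤ 4 * (d : ℝ) / n := by
    rw [le_div_iff₀ hn']; linarith
  rw [deviationBound, Real.one_le_sqrt]
  nlinarith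

theorem isProbabilityMeasure_egoDist {Ω : Type*} [MeasurableSpace Ω] {n p k : ℕ}
    [MeasurableSpace (EgoGraph k p)] (P : Measure Ω) [IsProbabilityMeasure P]
    (G : Ω → AttrGraph n p) (hG : ∀ v, Measurable fun ω => (G ω).ego k v) (hn : 0 < n) :
    IsProbabilityMeasure (egoDist k P G) :=
  isProbabilityMeasure_of_average hn hG rfl

theorem theorem1
    {k p N nS nT d : ℕ} {Z : Type*}
    -- the space of ego-graphs, with the distance used in the Wasserstein distance
    [PseudoMetricSpace (EgoGraph k p)] [TopologicalSpace.SeparableSpace (EgoGraph k p)]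
    [MeasurableSpace (EgoGraph k p)] [BorelSpace (EgoGraph k p)]
    -- the (random) source graph and the (random) target graph
    {ΩS : Type*} [MeasurableSpace ΩS] (QS : Measure ΩS) [IsProbabilityMeasure QS]
    (GS : ΩS → AttrGraph N p) (hGS : ∀ v, Measurable fun ω => (GS ω).ego k v)
    {ΩT : Type*} [MeasurableSpace ΩT] (QT : Measure ΩT) [IsProbabilityMeasure QT]
    (GT : ΩT → AttrGraph nT p) (hGT : ∀ v, Measurable fun ω => (GT ω).ego k v)
    (hnT : 0 < nT)
    -- the source sample: `nS` independent ego-graphs whose average law is that of the ego-graphs of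
    -- `GS` (for instance i.i.d. ones, or all ego-graphs of `GS` where these are independent)
    {Ω : Type*} [MeasurableSpace Ω] (P : Measure Ω) [IsProbabilityMeasure P]
    (E : Fin nS → Ω → EgoGraph k p) (hE : ∀ i, Measurable (E i)) (hind : iIndepFun E P)
    (hlaw : (nS : ℝ≥0∞)⁻¹ • ∑ i, P.map (E i) = egoDist k QS GS) (hnS : 0 < nS)
    -- the true labeling functions
    (ψS ψT : EgoGraph k p → unitInterval) (hψS : Measurable ψS) (hψT : Measurable ψT)
    -- the models `g ∘ f`, their Lipschitz constant and their pseudo-dimension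
    (M : Set ((Z → unitInterval) × (EgoGraph k p → Z)))
    (L : ℝ≥0) (hL : ∀ m ∈ M, LipschitzWith L (m.1 ∘ m.2))
    (hd : pseudoDim (hypothesisSet M) = d) (hdn : d ≤ 2 * nS)
    (δ : ℝ) (hδ0 : 0 < δ) (hδ1 : δ < 1) :
    ∃ A : Set Ω, MeasurableSet A ∧ ENNReal.ofReal (1 - δ) ≤ P A ∧
      ∀ ω ∈ A, ∀ g f, (g, f) ∈ M →
        ENNReal.ofReal (risk (egoDist k QT GT) ψT (g ∘ f)) ≤
          ENNReal.ofReal (empiricalRisk (fun i => E i ω) ψS (g ∘ f)) +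
          ENNReal.ofReal
            (jointError (egoDist k QS GS) (egoDist k QT GT) ψS ψT (hypothesisSet M)) +
          2 * (L : ℝ≥0∞) * wassersteinOne (egoDist k QS GS) (egoDist k QT GT) +
          ENNReal.ofReal (Real.sqrt
            (4 * (d : ℝ) / nS * Real.log (Real.exp 1 * nS / d) + 1 / nS * Real.log (1 / δ))) := by
  have hT := isProbabilityMeasure_egoDist QT GT hGT hnT
  have hS := isProbabilityMeasure_of_average hnS hE hlaw
  set H := hypothesisSet M with hH
  have hLH : ∀ h ∈ H, LipschitzWith L h := by
    rintro _ ⟨m, hm, rfl⟩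
    exact hL m hm
  have hdim := card_le_of_pseudoDim_eq hd
  have hmem {g : Z → unitInterval} {f : EgoGraph k p → Z} (hgf : (g, f) ∈ M) : g ∘ f ∈ H :=
    ⟨(g, f), hgf, rfl⟩
  change ∃ A : Set Ω, MeasurableSet A ∧ ENNReal.ofReal (1 - δ) ≤ P A ∧
      ∀ ω ∈ A, ∀ g f, (g, f) ∈ M →
        ENNReal.ofReal (risk (egoDist k QT GT) ψT (g ∘ f)) ≤
          ENNReal.ofReal (empiricalRisk (fun i => E i ω) ψS (g ∘ f)) +
          ENNReal.ofReal (jointError (egoDist k QS GS) (egoDist k QT GT) ψS ψT H) +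
          2 * (L : ℝ≥0∞) * wassersteinOne (egoDist k QS GS) (egoDist k QT GT) +
          ENNReal.ofReal (deviationBound nS d δ)
  -- The estimate by Sauer's lemma needs `d ≤ nS`. Otherwise the root is at least 1, which bounds
  -- every risk, and the whole sample space serves as `A`.
  rcases le_or_gt d nS with hdn' | hdn'
  · obtain ⟨A, hAm, hA, hAr⟩ := exists_measurableSet_forall_risk_le hnS hdn' hE hind hlaw hdim hLH
      hψS hδ0 hδ1.le
    refine ⟨A, hAm, hA, fun ω hω g f hgf => ?_⟩
    have h1 := risk_target_le (egoDist k QS GS) (egoDist k QT GT) hψS hψT hLH (hmem hgf)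
    have h2 : ENNReal.ofReal (risk (egoDist k QS GS) ψS (g ∘ f)) ≤
        ENNReal.ofReal (empiricalRisk (fun i => E i ω) ψS (g ∘ f)) +
          ENNReal.ofReal (deviationBound nS d δ) :=
      (ENNReal.ofReal_le_ofReal (hAr ω hω _ (hmem hgf))).trans ENNReal.ofReal_add_le
    refine h1.trans ((add_le_add_left (add_le_add_left h2 _) _).trans (le_of_eq ?_))
    ring
  · refine ⟨Set.univ, MeasurableSet.univ, ?_, fun ω _ g f hgf => ?_⟩
    · rw [measure_univ]
      exact ENNReal.ofReal_le_one.2 (by linarith)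
    · refine le_add_left (ENNReal.ofReal_le_ofReal ?_)
      exact (risk_mem_unit _ hψT (hLH _ (hmem hgf)).continuous.measurable).2.trans
        (one_le_deviationBound hnS hdn'.le hdn hδ0 hδ1.le)
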